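/- Let $N\ge 3$ and let $\Gamma_1,\dots,\Gamma_N$ be arbitrary nonzero real numbers (vortex strengths). Let $M$ be the manifold of $N$-tuples $v=(v_1,\dots,v_N)$ of pairwise distinct points of the unit sphere $S^2\subset\mathbb R^3$, let $$H(v)=-\frac1{4\pi}\sum_{i<j}\Gamma_i\Gamma_j\ln\left(\|v_i-v_j\|^2\right),\qquad v\in M,$$ and consider on $M$ the equations of motion of the $N$-vortex problem on the sphere, $$\dot v_j=-\frac1{\Gamma_j}\,v_j\times\nabla_{v_j}H(v),\qquad j=1,\dots,N.$$ The group $SO(3)$ acts on $M$ by $g.v=(gv_1,\dots,gv_N)$; for $\theta\in\mathbb R$ let $R_\theta\in SO(3)$ be the rotation by the angle $\theta$ about the $z$-axis, and let $SO(2)=\{R_\theta:\theta\in\mathbb R\}$. A relative equilibrium with angular velocity $\omega\in\mathbb R$ is a configuration $a\in M$ such that $v(t)=R_{\omega t}.a$ is a solution of the equations of motion; then all points of $SO(2).a$ are relative equilibria with the same angular velocity. A submanifold $P\subset M$ is called a nondegenerate critical manifold of $H:M\to\mathbb R$ if each $x\in P$ is a critical point of $H$ and the null-space of the Hessian $d^2H(x)$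 on $T_xM$ equals $T_xP$. Let $a_0\in M$ be an equilibrium of the equations of motion such that $SO(3).a_0$ is a nondegenerate critical manifold of $H$. Then there are $\omega_0>0$ and configurations $a_1(\omega),a_2(\omega)\in M$, for $\omega\in(-\omega_0,\omega_0)$, such that for every $\omega\in(-\omega_0,\omega_0)$ both $a_1(\omega)$ and $a_2(\omega)$ are relative equilibria with angular velocity $\omega$ and $SO(2).a_1(\omega)\ne SO(2).a_2(\omega)$; moreover, $a_1(\omega)$ and $a_2(\omega)$ approach the orbit $SO(3).a_0$ as $\omega\to0$, that is, for every neighbourhood $U$ of $SO(3).a_0$ both lie in $U$ for all sufficiently small $|\omega|$. -/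

import Mathlib

/-! The `N`-vortex problem on the unit sphere of `ℝ³`. -/

namespace SphereVortex

noncomputable section

/-- Euclidean three-space. -/
abbrev E3 : Type := EuclideanSpace ℝ (Fin 3)

/-- The space `(ℝ³)^N` in which all configurations of `N` vortices live. -/
abbrev Config (N : ℕ) : Type := Fin N → E3

/-- The cross product on Euclidean three-space. -/
def cross (u w : E3) : E3 := WithLp.toLp 2 (crossProduct u.ofLp w.ofLp)

/-- The phase space `M`: `N` pairwise distinct points of the unit sphere. -/
def phaseSpace (N : ℕ) : Set (Config N) :=
  {v | (∀ i, ‖v i‖ = 1) ∧ Function.Injective v}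

/-- The Hamiltonian `H(v) = -(1/4π) ∑_{i<j} Γ_i Γ_j ln ‖v_i - v_j‖²`. -/
def hamiltonian {N : ℕ} (Γ : Fin N → ℝ) (v : Config N) : ℝ :=
  -(1 / (4 * Real.pi)) *
    ∑ i, ∑ j ∈ Finset.Ioi i, Γ i * Γ j * Real.log (‖v i - v j‖ ^ 2)

/-- The partial gradient `∇_{v_j} f(v) ∈ ℝ³`. -/
def partialGradient {N : ℕ} (f : Config N → ℝ) (v : Config N) (j : Fin N) : E3 :=
  gradient (fun u : E3 => f (Function.update v j u)) (v j)

/-- The vector field of the equations of motion `v̇_j = -(1/Γ_j) v_j × ∇_{v_j} H`. -/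
def vortexField {N : ℕ} (Γ : Fin N → ℝ) (v : Config N) : Config N :=
  fun j => -(1 / Γ j) • cross (v j) (partialGradient (hamiltonian Γ) v j)

/-- `v` is a (global) solution in `M` of the equations of motion. -/
def IsSolution {N : ℕ} (Γ : Fin N → ℝ) (v : ℝ → Config N) : Prop :=
  ∀ t, v t ∈ phaseSpace N ∧ HasDerivAt v (vortexField Γ (v t)) t

/-- The simultaneous action of a matrix on all vortices, `g.v = (g v_1, …, g v_N)`. -/
def act {N : ℕ} (g : Matrix (Fin 3) (Fin 3) ℝ) (v : Config N) : Config N :=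
  fun i => WithLp.toLp 2 (g.mulVec (v i).ofLp)

/-- The orbit `SO(3).a`. -/
def orbitSO3 {N : ℕ} (a : Config N) : Set (Config N) :=
  {v | ∃ g ∈ Matrix.specialOrthogonalGroup (Fin 3) ℝ, v = act g a}

/-- The rotation `e^{θ J₃}` of angle `θ` about the `z`-axis. -/
def rotZ (θ : ℝ) : Matrix (Fin 3) (Fin 3) ℝ :=
  !![Real.cos θ, -Real.sin θ, 0;
     Real.sin θ, Real.cos θ, 0;
     0, 0, 1]

/-- The orbit `SO(2).a`, where `SO(2)` is the group of rotations about the `z`-axis. -/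
def orbitSO2 {N : ℕ} (a : Config N) : Set (Config N) :=
  {v | ∃ θ : ℝ, v = act (rotZ θ) a}

/-- `a` is an equilibrium: the constant curve `a` solves the equations of motion. -/
def IsEquilibrium {N : ℕ} (Γ : Fin N → ℝ) (a : Config N) : Prop :=
  IsSolution Γ (fun _ => a)

/-- `(a, ω)` is a relative equilibrium: `t ↦ e^{ω t J₃}.a` solves the equations of motion. -/
def IsRelativeEquilibrium {N : ℕ} (Γ : Fin N → ℝ) (a : Config N) (ω : ℝ) : Prop :=
  a ∈ phaseSpace N ∧ IsSolution Γ (fun t => act (rotZ (ω * t)) a)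

/-- The tangent space `T_x M` at a point `x` of the phase space, as a subspace of `(ℝ³)^N`. -/
def tangentM {N : ℕ} (x : Config N) : Submodule ℝ (Config N) where
  carrier := {w | ∀ i, inner ℝ (x i) (w i) = 0}
  add_mem' := by
    intro a b ha hb i
    simp [inner_add_right, ha i, hb i]
  zero_mem' := by
    intro i
    simp
  smul_mem' := by
    intro c a ha i
    simp [inner_smul_right, ha i]

/-- `f` composed with the radial retraction `(v_i) ↦ (v_i / ‖v_i‖)` onto the product of spheres;
it only depends on the restriction of `f` to that product. For `x ∈ M` the map
`w ↦ (x_i + w_i) / ‖x_i + w_i‖` on `T_x M` is the inverse of a chart of `M` centred at `x` whose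
derivative at `0` is the identity of `T_x M`, so the first two derivatives of `radialExt f` at `x`
in directions of `T_x M` are those of the function `f` on `M` in this chart. -/
def radialExt {N : ℕ} (f : Config N → ℝ) (v : Config N) : ℝ :=
  f (fun i => ‖v i‖⁻¹ • v i)

/-- `x` is a critical point of the restriction of `f` to `M`. -/
def IsCriticalPoint {N : ℕ} (f : Config N → ℝ) (x : Config N) : Prop :=
  x ∈ phaseSpace N ∧ ∀ w ∈ tangentM x, fderiv ℝ (radialExt f) x w = 0

/-- The Hessian `d²f(x)(w, w')` (for `w, w' ∈ T_x M`) of the restriction of `f` to `M` at a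
critical point `x`. -/
def hessian {N : ℕ} (f : Config N → ℝ) (x w w' : Config N) : ℝ :=
  fderiv ℝ (fderiv ℝ (radialExt f)) x w w'

/-- The null-space of the bilinear form `d²f(x)` on `T_x M`. -/
def hessianKer {N : ℕ} (f : Config N → ℝ) (x : Config N) : Set (Config N) :=
  {w | w ∈ tangentM x ∧ ∀ w' ∈ tangentM x, hessian f x w w' = 0}

/-- `P` is a smooth embedded submanifold of `(ℝ³)^N`: around each of its points a local
diffeomorphism straightens it to a linear subspace. -/
def IsSubmanifold {N : ℕ} (P : Set (Config N)) : Prop :=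
  ∀ x ∈ P, ∃ (φ : OpenPartialHomeomorph (Config N) (Config N))
    (S : Submodule ℝ (Config N)), x ∈ φ.source ∧
      ContDiffOn ℝ (⊤ : ℕ∞) φ φ.source ∧ ContDiffOn ℝ (⊤ : ℕ∞) φ.symm φ.target ∧
      φ '' (φ.source ∩ P) = φ.target ∩ S

/-- The tangent space `T_x P` of a submanifold: velocities of smooth curves in `P` through `x`. -/
def tangentVectors {N : ℕ} (P : Set (Config N)) (x : Config N) : Set (Config N) :=
  {w | ∃ γ : ℝ → Config N, ContDiff ℝ (⊤ : ℕ∞) γ ∧ (∀ t, γ t ∈ P) ∧ γ 0 = x ∧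
    HasDerivAt γ w 0}

/-- Bott's nondegeneracy: `P` is a submanifold of `M` consisting of critical points `x` of `f`
(as a function on `M`), and `ker d²f(x) = T_x P` at each of them. -/
def IsNondegenerateCriticalManifold {N : ℕ} (f : Config N → ℝ) (P : Set (Config N)) : Prop :=
  P ⊆ phaseSpace N ∧ IsSubmanifold P ∧
    ∀ x ∈ P, IsCriticalPoint f x ∧ hessianKer f x = tangentVectors P x

end

end SphereVortex

/-!
A configuration `a` turns rigidly about the `z`-axis with angular velocity `ω` exactly when it is
a critical point on `M` of the augmented Hamiltonian `H(v) - ⟪∑ Γ_j v_j, ω e₃⟫`; only the direction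
from critical points to solutions is needed (`isRelativeEquilibrium_of_critical`). Since `H` is
invariant under rotations, the `z`-axis may be replaced by an arbitrary angular velocity vector
`ξ ∈ ℝ³`, provided that the resulting configuration is rotated back afterwards
(`hasFDerivAt_augmented_act`). All functions are extended to `(ℝ³)^N` by the radial retraction,
which replaces the manifold `M` by an open set of a vector space.

Let `W` be a complement of the null-space of the Hessian at `a₀` in the tangent space. By Bott
nondegeneracy the Hessian is nondegenerate on `W`, and the null-space consists of infinitesimal
rotations of `a₀` (`exists_skew_of_mem_tangentVectors`, `exists_slice`). The implicit function
theorem yields configurations `u(ξ) ∈ a₀ + W`, for small `ξ`, which are critical for the augmented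
Hamiltonian in the directions of `W` (`exists_reduction`). The radial directions never contribute,
so at `u(ξ)` only the infinitesimal rotations remain to be checked
(`eventually_eq_zero_of_span`). There the derivative of the augmented Hamiltonian is, up to sign,
the derivative of the reduced function `φ(ξ) = H(u(ξ)) - ⟪∑ Γ_j u_j(ξ), ξ⟫` along the sphere
through `ξ`, so it vanishes at the maximisers and minimisers of `φ` on the sphere `‖ξ‖ = |ω|`
(`hasFDerivAt_of_extremal`).

The maximum and the minimum give the two relative equilibria. If the two values of `φ` differ,
the `SO(2)`-orbits differ because the augmented Hamiltonian is `SO(2)`-invariant. Otherwise `φ` is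
constant on the sphere and two antipodal points may be taken: equality of the orbits would give a
rotation reversing a direction but moving a configuration near `a₀` to another such, which is
impossible as three distinct points of the sphere have trivial stabiliser
(`eventually_op_ne_neg`).
-/

namespace SphereVortex

open Matrix Filter Topology

noncomputable section

/-! ### The augmented Hamiltonian and its symmetries -/

/-- The radial retraction `(v_i) ↦ (v_i / ‖v_i‖)` onto the product of spheres. -/
def normalize {N : ℕ} (v : Config N) : Config N := fun i => ‖v i‖⁻¹ • v i

/-- The momentum `∑ Γ_j v_j` of the rotation action. -/
def momentum {N : ℕ} (Γ : Fin N → ℝ) (v : Config N) : E3 := ∑ j, Γ j • v j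

/-- The augmented Hamiltonian `H(v) - ⟪∑ Γ_j v_j, ξ⟫` with the angular velocity vector `ξ` as a
parameter, extended to `(ℝ³)^N` by the radial retraction. -/
def augmented {N : ℕ} (Γ : Fin N → ℝ) (ξ : E3) (v : Config N) : ℝ :=
  radialExt (hamiltonian Γ) v - inner ℝ (momentum Γ (normalize v)) ξ

/-- The configurations at which the retraction is smooth and its value has no collisions. -/
def regularSet (N : ℕ) : Set (Config N) :=
  {v | (∀ i, v i ≠ 0) ∧ Function.Injective (normalize v)}

section

variable {N : ℕ} {Γ : Fin N → ℝ} {ξ : E3} {v : Config N}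

lemma normalize_of_unit (hv : ∀ i, ‖v i‖ = 1) : normalize v = v := by
  ext1 i; simp [normalize, hv i]

lemma norm_normalize (hv : ∀ i, v i ≠ 0) (i : Fin N) : ‖normalize v i‖ = 1 := by
  simp [normalize, norm_smul, hv i]

lemma normalize_mem_phaseSpace (hv : v ∈ regularSet N) : normalize v ∈ phaseSpace N :=
  ⟨norm_normalize hv.1, hv.2⟩

lemma phaseSpace_subset_regularSet : phaseSpace N ⊆ regularSet N := fun v hv =>
  ⟨fun i h => by simpa [h] using hv.1 i, by rw [normalize_of_unit hv.1]; exact hv.2⟩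

lemma normalize_smul {s : Fin N → ℝ} (hs : ∀ i, 0 < s i) (v : Config N) :
    normalize (fun i => s i • v i) = normalize v := by
  ext1 i
  have := (hs i).ne'
  simp only [normalize, norm_smul, Real.norm_eq_abs, abs_of_pos (hs i), mul_inv, smul_smul]
  congr 1
  field_simp

lemma normalize_map {U : E3 →L[ℝ] E3} (hU : ∀ x, ‖U x‖ = ‖x‖) (v : Config N) :
    normalize (fun i => U (v i)) = fun i => U (normalize v i) := by
  ext1 i
  simp [normalize, hU]

lemma hamiltonian_map {U : E3 →L[ℝ] E3} (hU : ∀ x, ‖U x‖ = ‖x‖) (v : Config N) :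
    hamiltonian Γ (fun i => U (v i)) = hamiltonian Γ v := by
  simp only [hamiltonian, ← map_sub, hU]

lemma augmented_smul {s : Fin N → ℝ} (hs : ∀ i, 0 < s i) (v : Config N) :
    augmented Γ ξ (fun i => s i • v i) = augmented Γ ξ v := by
  have h := normalize_smul hs v
  simp only [augmented, radialExt, h]
  rw [show (fun i => ‖s i • v i‖⁻¹ • s i • v i) = normalize v from h]
  rfl

/-- Rotating the configuration amounts to rotating the angular velocity vector backwards. -/
lemma augmented_map {U U' : E3 →L[ℝ] E3} (hU : ∀ x, ‖U x‖ = ‖x‖)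
    (hUU' : ∀ x y, inner ℝ (U x) y = inner ℝ x (U' y)) (ξ : E3) (v : Config N) :
    augmented Γ ξ (fun i => U (v i)) = augmented Γ (U' ξ) v := by
  have h := normalize_map hU v
  have h1 : radialExt (hamiltonian Γ) (fun i => U (v i)) = radialExt (hamiltonian Γ) v := by
    change hamiltonian Γ (normalize _) = _
    rw [h, hamiltonian_map hU]; rfl
  have h2 : momentum Γ (fun i => U (normalize v i)) = U (momentum Γ (normalize v)) := by
    simp [momentum]
  rw [augmented, h1, h, h2, hUU', augmented]

lemma contDiffAt_normalize {n : WithTop ℕ∞} (hv : ∀ i, v i ≠ 0) :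
    ContDiffAt ℝ n (normalize (N := N)) v := by
  rw [contDiffAt_pi]
  intro i
  have h : ContDiffAt ℝ n (fun w : Config N => w i) v := contDiffAt_apply ℝ E3 i v
  exact ((h.norm ℝ (hv i)).inv (by simpa using hv i)).smul h

lemma contDiffAt_hamiltonian {n : WithTop ℕ∞} (hv : Function.Injective v) :
    ContDiffAt ℝ n (hamiltonian Γ) v := by
  unfold hamiltonian
  refine contDiffAt_const.mul (ContDiffAt.sum fun i _ => ContDiffAt.sum fun j hj => ?_)
  refine contDiffAt_const.mul (ContDiffAt.log ?_ ?_)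
  · exact ((contDiffAt_apply ℝ E3 i v).sub (contDiffAt_apply ℝ E3 j v)).norm_sq ℝ
  · have : v i ≠ v j := fun h => (Finset.mem_Ioi.mp hj).ne (hv h)
    simpa [sub_eq_zero] using this

lemma contDiffAt_radialExt {n : WithTop ℕ∞} (hv : v ∈ regularSet N) :
    ContDiffAt ℝ n (radialExt (hamiltonian Γ)) v :=
  (contDiffAt_hamiltonian hv.2).comp v (contDiffAt_normalize hv.1)

lemma contDiff_momentum {n : WithTop ℕ∞} : ContDiff ℝ n (momentum (N := N) Γ) := by
  unfold momentum
  exact ContDiff.sum fun i _ => (contDiff_apply ℝ E3 i).const_smul _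

lemma contDiffAt_momentum_normalize {n : WithTop ℕ∞} (hv : ∀ i, v i ≠ 0) :
    ContDiffAt ℝ n (fun w => momentum Γ (normalize w)) v :=
  contDiff_momentum.contDiffAt.comp v (contDiffAt_normalize hv)

lemma contDiffAt_augmented {n : WithTop ℕ∞} (hv : v ∈ regularSet N) :
    ContDiffAt ℝ n (augmented Γ ξ) v :=
  (contDiffAt_radialExt hv).sub ((contDiffAt_momentum_normalize hv.1).inner ℝ contDiffAt_const)

/-- Normalising a critical configuration of the augmented Hamiltonian keeps it critical. -/
lemma hasFDerivAt_augmented_normalize (hv : ∀ i, v i ≠ 0)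
    (h : HasFDerivAt (augmented Γ ξ) (0 : Config N →L[ℝ] ℝ) v) :
    HasFDerivAt (augmented Γ ξ) (0 : Config N →L[ℝ] ℝ) (normalize v) := by
  let L : Config N →L[ℝ] Config N :=
    ContinuousLinearMap.pi fun i => ‖v i‖ • ContinuousLinearMap.proj i
  have hL : L (normalize v) = v := by
    ext1 i
    simp [L, normalize, smul_smul, mul_inv_cancel₀ (norm_ne_zero_iff.mpr (hv i))]
  have h1 : augmented Γ ξ = augmented Γ ξ ∘ L :=
    funext fun w => (augmented_smul (fun i => norm_pos_iff.mpr (hv i)) w).symm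
  rw [h1]
  have := HasFDerivAt.comp (g := augmented Γ ξ) (normalize v) (by rwa [hL]) L.hasFDerivAt
  simpa using this

/-! ### Relative equilibria as critical points -/

/-- The operator on Euclidean three-space given by a matrix. -/
abbrev op (g : Matrix (Fin 3) (Fin 3) ℝ) : E3 →L[ℝ] E3 := Matrix.toEuclideanCLM (𝕜 := ℝ) g

lemma act_apply (g : Matrix (Fin 3) (Fin 3) ℝ) (v : Config N) (i : Fin N) :
    act g v i = op g (v i) := rfl

lemma mem_SO3_iff {g : Matrix (Fin 3) (Fin 3) ℝ} :
    g ∈ specialOrthogonalGroup (Fin 3) ℝ ↔ g * gᵀ = 1 ∧ g.det = 1 := by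
  rw [mem_specialOrthogonalGroup_iff, mem_orthogonalGroup_iff]

lemma transpose_mul_self_of_mem_SO3 {g : Matrix (Fin 3) (Fin 3) ℝ}
    (hg : g ∈ specialOrthogonalGroup (Fin 3) ℝ) : gᵀ * g = 1 :=
  mul_eq_one_comm.mp (mem_SO3_iff.mp hg).1

lemma transpose_mem_SO3 {g : Matrix (Fin 3) (Fin 3) ℝ}
    (hg : g ∈ specialOrthogonalGroup (Fin 3) ℝ) : gᵀ ∈ specialOrthogonalGroup (Fin 3) ℝ := by
  rw [mem_SO3_iff]
  exact ⟨by simpa using transpose_mul_self_of_mem_SO3 hg, by simpa using (mem_SO3_iff.mp hg).2⟩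

lemma inner_op (g : Matrix (Fin 3) (Fin 3) ℝ) (x y : E3) :
    inner ℝ (op g x) y = inner ℝ x (op gᵀ y) := by
  have : op gᵀ = ContinuousLinearMap.adjoint (op g) := by
    have := map_star (Matrix.toEuclideanCLM (n := Fin 3) (𝕜 := ℝ)) g
    rw [star_eq_conjTranspose, conjTranspose_eq_transpose_of_trivial] at this
    exact this
  rw [this, ContinuousLinearMap.adjoint_inner_right]

lemma op_mul_apply (g h : Matrix (Fin 3) (Fin 3) ℝ) (x : E3) : op (g * h) x = op g (op h x) := by
  simp [op]

lemma op_one_apply (x : E3) : op 1 x = x := by simp [op]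

lemma norm_op {g : Matrix (Fin 3) (Fin 3) ℝ} (hg : g ∈ specialOrthogonalGroup (Fin 3) ℝ)
    (x : E3) : ‖op g x‖ = ‖x‖ := by
  have h : ‖op g x‖ ^ 2 = ‖x‖ ^ 2 := by
    rw [← real_inner_self_eq_norm_sq, inner_op, ← op_mul_apply, transpose_mul_self_of_mem_SO3 hg,
      op_one_apply, real_inner_self_eq_norm_sq]
  exact (sq_eq_sq₀ (norm_nonneg _) (norm_nonneg _)).mp h

lemma act_act (g h : Matrix (Fin 3) (Fin 3) ℝ) (v : Config N) : act g (act h v) = act (g * h) v :=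
  funext fun i => (op_mul_apply g h (v i)).symm

lemma act_one (v : Config N) : act 1 v = v := by
  ext1 i; simp [act_apply, op]

lemma act_mem_phaseSpace {g : Matrix (Fin 3) (Fin 3) ℝ}
    (hg : g ∈ specialOrthogonalGroup (Fin 3) ℝ) (hv : v ∈ phaseSpace N) :
    act g v ∈ phaseSpace N := by
  refine ⟨fun i => by rw [act_apply, norm_op hg, hv.1 i], fun i j hij => hv.2 ?_⟩
  have : ‖op g (v i - v j)‖ = 0 := by
    rw [map_sub, ← act_apply, ← act_apply, hij, sub_self, norm_zero]
  rw [norm_op hg, norm_eq_zero, sub_eq_zero] at this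
  exact this

lemma augmented_act {g : Matrix (Fin 3) (Fin 3) ℝ}
    (hg : g ∈ specialOrthogonalGroup (Fin 3) ℝ) (ξ : E3) (v : Config N) :
    augmented Γ (op g ξ) (act g v) = augmented Γ ξ v := by
  have := augmented_map (Γ := Γ) (norm_op hg) (inner_op g) (op g ξ) v
  rw [← op_mul_apply, transpose_mul_self_of_mem_SO3 hg, op_one_apply] at this
  exact this

lemma hasFDerivAt_augmented_act {g : Matrix (Fin 3) (Fin 3) ℝ}
    (hg : g ∈ specialOrthogonalGroup (Fin 3) ℝ)
    (h : HasFDerivAt (augmented Γ ξ) (0 : Config N →L[ℝ] ℝ) v) :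
    HasFDerivAt (augmented Γ (op g ξ)) (0 : Config N →L[ℝ] ℝ) (act g v) := by
  let L : Config N →L[ℝ] Config N :=
    ContinuousLinearMap.pi fun i => (op gᵀ).comp (ContinuousLinearMap.proj i)
  have hL : ∀ w, L w = act gᵀ w := fun w => rfl
  have hLv : L (act g v) = v := by
    rw [hL, act_act, transpose_mul_self_of_mem_SO3 hg, act_one]
  have h1 : augmented Γ (op g ξ) = augmented Γ ξ ∘ L := funext fun w => by
    rw [Function.comp_apply, hL, ← augmented_act hg ξ (act gᵀ w), act_act,
      (mem_SO3_iff.mp hg).1, act_one]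
  rw [h1]
  have := HasFDerivAt.comp (g := augmented Γ ξ) (act g v) (by rwa [hLv]) L.hasFDerivAt
  simpa using this

/-- The north pole, the axis of the rotations `rotZ θ`. -/
def e3 : E3 := EuclideanSpace.single 2 1

lemma rotZ_mem_SO3 (θ : ℝ) : rotZ θ ∈ specialOrthogonalGroup (Fin 3) ℝ := by
  have h := Real.sin_sq_add_cos_sq θ
  rw [mem_SO3_iff]
  constructor
  · ext i j
    fin_cases i <;> fin_cases j <;>
      simp [rotZ, Matrix.mul_apply, Fin.sum_univ_three] <;> nlinarith
  · simp [rotZ, Matrix.det_fin_three]; nlinarith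

lemma op_rotZ_e3 (θ : ℝ) : op (rotZ θ) e3 = e3 := by
  ext i
  fin_cases i <;> simp [rotZ, e3, op, Matrix.mulVec, dotProduct]

lemma cross_smul_self (c : ℝ) (x : E3) : cross x (c • x) = 0 := by
  simp [cross]

lemma cross_sub (x y z : E3) : cross x (y - z) = cross x y - cross x z := by
  simp [cross, map_sub]

/-- A vector orthogonal to all vectors orthogonal to the unit vector `p` is a multiple of `p`. -/
lemma eq_smul_of_inner_eq_zero {p x : E3} (hp : ‖p‖ = 1)
    (h : ∀ τ, inner ℝ p τ = 0 → inner ℝ x τ = 0) : x = (inner ℝ p x : ℝ) • p := by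
  set τ := x - (inner ℝ p x : ℝ) • p with hτ
  have h0 : inner ℝ p τ = 0 := by
    simp [hτ, inner_sub_right, inner_smul_right, hp]
  have h1 : inner ℝ τ τ = 0 := by
    nth_rewrite 1 [hτ]
    rw [inner_sub_left, inner_smul_left, h τ h0, h0]; simp
  exact sub_eq_zero.mp (inner_self_eq_zero.mp h1)

lemma inner_partialGradient (hv : Function.Injective v) (j : Fin N) (τ : E3) :
    inner ℝ (partialGradient (hamiltonian Γ) v j) τ =
      fderiv ℝ (hamiltonian Γ) v (Pi.single j τ) := by
  have h1 : HasFDerivAt (hamiltonian Γ) (fderiv ℝ (hamiltonian Γ) v) v :=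
    ((contDiffAt_hamiltonian (n := 1) hv).differentiableAt (by simp)).hasFDerivAt
  have h2 := HasFDerivAt.comp (g := hamiltonian Γ) (v j) (by rwa [Function.update_eq_self])
    (hasFDerivAt_update (𝕜 := ℝ) v (i := j) (v j))
  have h3 := h2.hasGradientAt.gradient
  rw [partialGradient]
  change gradient (hamiltonian Γ ∘ Function.update v j) (v j) = _ at h3
  rw [show (fun u => hamiltonian Γ (Function.update v j u)) =
    hamiltonian Γ ∘ Function.update v j from rfl, h3,
    InnerProductSpace.toDual_symm_apply, ContinuousLinearMap.comp_apply]
  congr 1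
  ext1 i
  by_cases hi : i = j
  · subst hi; simp
  · simp [hi]

/-- At a unit configuration the retraction is the identity to first order in tangential
directions. -/
lemma hasDerivAt_normalize_line (hv : ∀ i, ‖v i‖ = 1) (w : Config N)
    (hw : ∀ i, inner ℝ (v i) (w i) = 0) :
    HasDerivAt (fun t : ℝ => normalize (v + t • w)) w 0 := by
  rw [hasDerivAt_pi]
  intro i
  have hl : HasDerivAt (fun t : ℝ => v i + t • w i) (w i) 0 := by
    simpa using ((hasDerivAt_id (0 : ℝ)).smul_const (w i)).const_add (v i)
  have hn : HasDerivAt (fun t : ℝ => ‖v i + t • w i‖ ^ 2) 0 0 := by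
    simpa [hw i] using hl.norm_sq
  have hs : HasDerivAt (fun t : ℝ => (√(‖v i + t • w i‖ ^ 2))⁻¹) 0 0 := by
    convert! (hn.sqrt (by simp [hv i])).inv (by simp [hv i]) using 1
    simp
  simp only [Real.sqrt_sq (norm_nonneg _)] at hs
  convert! hs.smul hl using 1
  simp [hv i]

/-- At a critical point of the augmented Hamiltonian the vortices move by rigid rotation. -/
lemma vortexField_of_critical (hΓ : ∀ i, Γ i ≠ 0) (hv : v ∈ phaseSpace N)
    (h : HasFDerivAt (augmented Γ ξ) (0 : Config N →L[ℝ] ℝ) v) (j : Fin N) :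
    vortexField Γ v j = -cross (v j) ξ := by
  set G := partialGradient (hamiltonian Γ) v j with hG
  have key : ∀ τ, inner ℝ (v j) τ = 0 → inner ℝ (G - Γ j • ξ) τ = 0 := by
    intro τ hτ
    set w : Config N := Pi.single j τ with hw
    have hline : HasDerivAt (fun t : ℝ => v + t • w) w 0 := by
      simpa using ((hasDerivAt_id (0 : ℝ)).smul_const w).const_add v
    have d0 : HasDerivAt (fun t : ℝ => augmented Γ ξ (v + t • w)) 0 0 := by
      exact HasFDerivAt.comp_hasDerivAt (f := fun t : ℝ => v + t • w) (0 : ℝ)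
        (l := augmented Γ ξ) (by simpa using h) hline
    have hvw : ∀ i, inner ℝ (v i) (w i) = 0 := by
      intro i
      by_cases hi : i = j
      · subst hi; simpa [hw] using hτ
      · simp [hw, hi]
    have hnorm := hasDerivAt_normalize_line hv.1 w hvw
    have hnv : normalize (v + (0 : ℝ) • w) = v := by simp [normalize_of_unit hv.1]
    have hH : HasFDerivAt (hamiltonian Γ) (fderiv ℝ (hamiltonian Γ) v) v :=
      ((contDiffAt_hamiltonian (n := 1) hv.2).differentiableAt (by simp)).hasFDerivAt
    have d1 := HasFDerivAt.comp_hasDerivAt (f := fun t : ℝ => normalize (v + t • w)) (0 : ℝ)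
      (l := hamiltonian Γ) (by rwa [hnv]) hnorm
    have d2 : HasDerivAt (fun t : ℝ => momentum Γ (normalize (v + t • w))) (momentum Γ w) 0 := by
      unfold momentum
      exact HasDerivAt.fun_sum fun i _ => (hasDerivAt_pi.mp hnorm i).const_smul (Γ i)
    have d3 := d1.sub (d2.inner ℝ (hasDerivAt_const (0 : ℝ) ξ))
    have e := d0.unique d3
    have hm : momentum Γ w = Γ j • τ := by
      rw [momentum, Finset.sum_eq_single j]
      · simp [hw]
      · intro i _ hi; simp [hw, hi]
      · simp
    rw [hw, ← inner_partialGradient hv.2, ← hG, ← hw, hm] at e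
    simp only [inner_zero_right, zero_add] at e
    rw [inner_smul_left] at e
    rw [inner_sub_left, inner_smul_left, real_inner_comm τ ξ]
    exact e.symm
  have h1 := eq_smul_of_inner_eq_zero (hv.1 j) key
  have h2 : cross (v j) G = Γ j • cross (v j) ξ := by
    have h3 : cross (v j) (G - Γ j • ξ) = 0 := by rw [h1]; exact cross_smul_self _ _
    rw [cross_sub, sub_eq_zero] at h3
    rw [h3]; simp [cross]
  rw [vortexField, ← hG, h2, smul_smul]
  have := hΓ j
  field_simp
  simp

lemma hasDerivAt_act_rotZ (ω t : ℝ) (x : E3) :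
    HasDerivAt (fun t => op (rotZ (ω * t)) x) (-cross (op (rotZ (ω * t)) x) (ω • e3)) t := by
  have hs : HasDerivAt (fun t => Real.sin (ω * t)) (Real.cos (ω * t) * ω) t := by
    simpa using ((hasDerivAt_id t).const_mul ω).sin
  have hc : HasDerivAt (fun t => Real.cos (ω * t)) (-Real.sin (ω * t) * ω) t := by
    simpa using ((hasDerivAt_id t).const_mul ω).cos
  have h : HasDerivAt (fun t => (op (rotZ (ω * t)) x).ofLp)
      (-cross (op (rotZ (ω * t)) x) (ω • e3)).ofLp t := by
    rw [hasDerivAt_pi]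
    intro i
    fin_cases i
    · convert! (hc.mul_const (x 0)).sub (hs.mul_const (x 1)) using 1
      · ext s
        simp [op, rotZ, Matrix.mulVec, dotProduct, Fin.sum_univ_three, sub_eq_add_neg]
      · simp [op, rotZ, cross, e3, dotProduct, Fin.sum_univ_three, crossProduct]
        ring
    · convert! (hs.mul_const (x 0)).add (hc.mul_const (x 1)) using 1
      · ext s
        simp [op, rotZ, Matrix.mulVec, dotProduct, Fin.sum_univ_three]
      · simp [op, rotZ, cross, e3, dotProduct, Fin.sum_univ_three, crossProduct]
        ring
    · simpa [op, rotZ, cross, e3, Matrix.mulVec, dotProduct, Fin.sum_univ_three, crossProduct] using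
        hasDerivAt_const t (x 2)
  exact (PiLp.hasFDerivAt_toLp (𝕜 := ℝ) 2 _).comp_hasDerivAt t h

/-- Critical points of the augmented Hamiltonian on the phase space are relative equilibria. -/
theorem isRelativeEquilibrium_of_critical (hΓ : ∀ i, Γ i ≠ 0) {ω : ℝ} (hv : v ∈ phaseSpace N)
    (h : HasFDerivAt (augmented Γ (ω • e3)) (0 : Config N →L[ℝ] ℝ) v) :
    IsRelativeEquilibrium Γ v ω := by
  refine ⟨hv, fun t => ⟨act_mem_phaseSpace (rotZ_mem_SO3 _) hv, ?_⟩⟩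
  have h1 := hasFDerivAt_augmented_act (rotZ_mem_SO3 (ω * t)) h
  rw [map_smul, op_rotZ_e3] at h1
  rw [hasDerivAt_pi]
  intro j
  rw [vortexField_of_critical hΓ (act_mem_phaseSpace (rotZ_mem_SO3 _) hv) h1 j]
  exact hasDerivAt_act_rotZ ω t (v j)

end

/-! ### Infinitesimal symmetries of the augmented Hamiltonian -/

section

variable {N : ℕ} {Γ : Fin N → ℝ} {ξ : E3} {v : Config N}

lemma hasDerivAt_augmented_comp (hv : v ∈ regularSet N) {c : ℝ → Config N} {w : Config N}
    (hc0 : c 0 = v) (hc : HasDerivAt c w 0) :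
    HasDerivAt (fun t => augmented Γ ξ (c t)) (fderiv ℝ (augmented Γ ξ) v w) 0 := by
  have h : HasFDerivAt (augmented Γ ξ) (fderiv ℝ (augmented Γ ξ) v) v :=
    ((contDiffAt_augmented (n := 1) hv).differentiableAt (by simp)).hasFDerivAt
  exact HasFDerivAt.comp_hasDerivAt (f := c) (0 : ℝ) (l := augmented Γ ξ) (by rwa [hc0]) hc

lemma fderiv_augmented_radial (hv : v ∈ regularSet N) (r : Fin N → ℝ) :
    fderiv ℝ (augmented Γ ξ) v (fun i => r i • v i) = 0 := by
  have hc : HasDerivAt (fun t : ℝ => fun i => (1 + t * r i) • v i) (fun i => r i • v i) 0 := by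
    rw [hasDerivAt_pi]
    intro i
    have := (((hasDerivAt_id (0 : ℝ)).mul_const (r i)).const_add 1).smul_const (v i)
    simpa using this
  have h1 := hasDerivAt_augmented_comp (Γ := Γ) (ξ := ξ) hv (by simp) hc
  have hpos : ∀ᶠ t : ℝ in 𝓝 0, ∀ i, 0 < 1 + t * r i := by
    rw [eventually_all]
    intro i
    have : ContinuousAt (fun t : ℝ => 1 + t * r i) 0 := by fun_prop
    exact this.eventually_const_lt (by simp)
  have h2 : (fun t : ℝ => augmented Γ ξ (fun i => (1 + t * r i) • v i)) =ᶠ[𝓝 0]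
      fun _ => augmented Γ ξ v := hpos.mono fun t ht => augmented_smul ht v
  exact (h1.congr_of_eventuallyEq h2.symm).unique (hasDerivAt_const _ _)

lemma exp_zero_smul_apply (X : E3 →L[ℝ] E3) (x : E3) : NormedSpace.exp ((0 : ℝ) • X) x = x := by
  have h : (0 : ℝ) • X = 0 := by ext; simp
  rw [h, NormedSpace.exp_zero, one_apply_eq_self]

lemma hasDerivAt_exp_smul_apply (X : E3 →L[ℝ] E3) (x : E3) :
    HasDerivAt (fun t : ℝ => NormedSpace.exp (t • X) x) (X x) 0 := by
  have h0 : NormedSpace.exp ((0 : ℝ) • X) = 1 :=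
    ContinuousLinearMap.ext (exp_zero_smul_apply X)
  have := (hasDerivAt_exp_smul_const (𝕂 := ℝ) X 0).clm_apply (hasDerivAt_const (0 : ℝ) x)
  rw [h0, one_mul, map_zero, add_zero] at this
  exact this

lemma star_eq_neg_of_skew {X : E3 →L[ℝ] E3} (hX : ∀ x y, inner ℝ (X x) y = -inner ℝ x (X y)) :
    star X = -X := by
  rw [ContinuousLinearMap.star_eq_adjoint]
  refine (ContinuousLinearMap.eq_adjoint_iff (-X) X).mpr (fun x y => ?_) |>.symm
  simp [hX]

lemma norm_exp_smul_apply {X : E3 →L[ℝ] E3} (hX : ∀ x y, inner ℝ (X x) y = -inner ℝ x (X y))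
    (t : ℝ) (x : E3) : ‖NormedSpace.exp (t • X) x‖ = ‖x‖ := by
  have hskew : t • X ∈ skewAdjoint (E3 →L[ℝ] E3) := by
    rw [skewAdjoint.mem_iff, star_smul, star_eq_neg_of_skew hX]; simp
  let _ : NormedAlgebra ℚ (E3 →L[ℝ] E3) := NormedAlgebra.restrictScalars ℚ ℝ _
  have h : NormedSpace.exp (t • X) ∈ unitary (E3 →L[ℝ] E3) :=
    NormedSpace.exp_mem_unitary_of_mem_skewAdjoint hskew
  rw [norm_eq_sqrt_real_inner, norm_eq_sqrt_real_inner,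
    ContinuousLinearMap.inner_map_map_of_mem_unitary h]

/-- Along infinitesimal rotations the derivative of the augmented Hamiltonian only sees the
rotation of the angular velocity vector. -/
lemma fderiv_augmented_skew (hv : v ∈ regularSet N) {X : E3 →L[ℝ] E3}
    (hX : ∀ x y, inner ℝ (X x) y = -inner ℝ x (X y)) :
    fderiv ℝ (augmented Γ ξ) v (fun i => X (v i)) =
      inner ℝ (momentum Γ (normalize v)) (X ξ) := by
  set U : ℝ → E3 →L[ℝ] E3 := fun t => NormedSpace.exp (t • X) with hU
  have hadj : ∀ t, ContinuousLinearMap.adjoint (U t) = NormedSpace.exp (t • (-X)) := by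
    intro t
    rw [← ContinuousLinearMap.star_eq_adjoint, hU, NormedSpace.star_exp]
    simp [star_eq_neg_of_skew hX]
  have hc : HasDerivAt (fun t : ℝ => fun i => U t (v i)) (fun i => X (v i)) 0 :=
    hasDerivAt_pi.mpr fun i => hasDerivAt_exp_smul_apply X (v i)
  have h1 := hasDerivAt_augmented_comp (Γ := Γ) (ξ := ξ) hv
    (by ext1 i; exact exp_zero_smul_apply X (v i)) hc
  have h2 : ∀ t, augmented Γ ξ (fun i => U t (v i)) = radialExt (hamiltonian Γ) v -
      inner ℝ (momentum Γ (normalize v)) (NormedSpace.exp (t • (-X)) ξ) := by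
    intro t
    rw [augmented_map (norm_exp_smul_apply hX t)
      (fun x y => (ContinuousLinearMap.adjoint_inner_right (U t) x y).symm) ξ v, hadj]
    rfl
  simp only [h2] at h1
  have h3 := (((hasDerivAt_const (0 : ℝ) (momentum Γ (normalize v))).inner ℝ
    (hasDerivAt_exp_smul_apply (-X) ξ)).const_sub (radialExt (hamiltonian Γ) v))
  have := h1.unique h3
  simpa using this

end

/-! ### Frames and rotations -/

lemma contDiff_cross {n : WithTop ℕ∞} : ContDiff ℝ n (fun x : E3 × E3 => cross x.1 x.2) := by
  unfold cross
  refine (PiLp.contDiff_toLp (𝕜 := ℝ) (p := 2)).comp (contDiff_pi.mpr fun i => ?_)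
  fin_cases i <;> simp [crossProduct] <;> fun_prop

lemma op_cross {g : Matrix (Fin 3) (Fin 3) ℝ} (hg : g ∈ specialOrthogonalGroup (Fin 3) ℝ)
    (p q : E3) : op g (cross p q) = cross (op g p) (op g q) := by
  -- The cofactor matrix of `g` is `g` itself.
  have hadj : g.adjugate = gᵀ := by
    have h : g.adjugate * (g * gᵀ) = gᵀ := by
      rw [← mul_assoc, adjugate_mul, (mem_SO3_iff.mp hg).2, one_smul, one_mul]
    rwa [(mem_SO3_iff.mp hg).1, mul_one] at h
  have h : g = g.adjugateᵀ := by rw [hadj, transpose_transpose]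
  have hc : op g.adjugateᵀ (cross p q) = cross (op g p) (op g q) := by
    ext i
    fin_cases i <;>
      simp [op, cross, crossProduct, adjugate_fin_three, mulVec, dotProduct,
        Fin.sum_univ_three] <;> ring
  rwa [← h] at hc

/-- The linear map sending the standard basis to `p`, `q` and `p × q`. -/
def frame (p q : E3) : E3 →L[ℝ] E3 :=
  (EuclideanSpace.proj 0).smulRight p + (EuclideanSpace.proj 1).smulRight q +
    (EuclideanSpace.proj 2).smulRight (cross p q)

lemma frame_apply (p q x : E3) : frame p q x = x 0 • p + x 1 • q + x 2 • cross p q := by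
  simp [frame]

lemma contDiff_frame {n : WithTop ℕ∞} : ContDiff ℝ n (fun x : E3 × E3 => frame x.1 x.2) := by
  have h : ∀ L : E3 →L[ℝ] ℝ, ContDiff ℝ n (fun p : E3 => L.smulRight p) := fun L =>
    (ContinuousLinearMap.smulRightL ℝ E3 E3 L).contDiff
  exact (((h _).comp contDiff_fst).add ((h _).comp contDiff_snd)).add ((h _).comp contDiff_cross)

lemma continuous_frame {Y : Type*} [TopologicalSpace Y] {f g : Y → E3} (hf : Continuous f)
    (hg : Continuous g) : Continuous (fun y => frame (f y) (g y)) := by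
  have h : ∀ (L : E3 →L[ℝ] ℝ) {p : Y → E3}, Continuous p →
      Continuous (fun y => L.smulRight (p y)) := fun L p hp =>
    (ContinuousLinearMap.smulRightL ℝ E3 E3 L).continuous.comp hp
  have hc : Continuous (fun y => cross (f y) (g y)) :=
    (contDiff_cross (n := 1)).continuous.comp (hf.prodMk hg)
  exact ((h _ hf).add (h _ hg)).add (h _ hc)

lemma op_mul_frame {g : Matrix (Fin 3) (Fin 3) ℝ} (hg : g ∈ specialOrthogonalGroup (Fin 3) ℝ)
    (p q : E3) : op g * frame p q = frame (op g p) (op g q) := by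
  ext1 x
  rw [mul_apply_eq_comp, frame_apply, frame_apply, map_add, map_add, map_smul,
    map_smul, map_smul, op_cross hg]

lemma isUnit_frame {p q : E3} (hp : ‖p‖ = 1) (hq : ‖q‖ = 1) (h1 : p ≠ q) (h2 : p ≠ -q) :
    IsUnit (frame p q) := by
  let M : Matrix (Fin 3) (Fin 3) ℝ := (Matrix.of ![p.ofLp, q.ofLp, (cross p q).ofLp])ᵀ
  have hM : frame p q = op M := by
    ext x i
    rw [frame_apply]
    fin_cases i <;> simp [M, op, mulVec, dotProduct, Fin.sum_univ_three, mul_comm]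
  have hpp := EuclideanSpace.real_norm_sq_eq p
  have hqq := EuclideanSpace.real_norm_sq_eq q
  have hdet : M.det = 1 - (inner ℝ p q : ℝ) ^ 2 := by
    have : (1 : ℝ) - (inner ℝ p q : ℝ) ^ 2 = ‖p‖ ^ 2 * ‖q‖ ^ 2 - (inner ℝ p q : ℝ) ^ 2 := by
      rw [hp, hq]; norm_num
    rw [this, hpp, hqq]
    simp [M, det_fin_three, cross, crossProduct, PiLp.inner_apply, Fin.sum_univ_three]
    ring
  have hne : M.det ≠ 0 := by
    rw [hdet]
    intro h
    have h' : ((inner ℝ p q : ℝ) - 1) * ((inner ℝ p q : ℝ) + 1) = 0 := by linarith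
    rcases mul_eq_zero.mp h' with h' | h'
    · exact h1 ((inner_eq_one_iff_of_norm_eq_one (𝕜 := ℝ) hp hq).mp (by linarith))
    · refine h2 ((inner_eq_one_iff_of_norm_eq_one (𝕜 := ℝ) hp (by simpa using hq)).mp ?_)
      rw [inner_neg_right]; linarith
  rw [hM]
  exact ((Matrix.isUnit_iff_isUnit_det M).mpr hne.isUnit).map _

lemma exists_isUnit_frame {N : ℕ} (hN : 3 ≤ N) {a : Config N} (ha : a ∈ phaseSpace N) :
    ∃ i j, IsUnit (frame (a i) (a j)) := by
  let k0 : Fin N := ⟨0, by omega⟩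
  let k1 : Fin N := ⟨1, by omega⟩
  let k2 : Fin N := ⟨2, by omega⟩
  have h01 : a k0 ≠ a k1 := fun h => by simpa [k0, k1] using ha.2 h
  have h02 : a k0 ≠ a k2 := fun h => by simpa [k0, k2] using ha.2 h
  have h12 : a k1 ≠ a k2 := fun h => by simpa [k1, k2] using ha.2 h
  by_cases h : a k0 = -a k1
  · refine ⟨k0, k2, isUnit_frame (ha.1 _) (ha.1 _) h02 fun h' => h12 ?_⟩
    exact neg_injective (h.symm.trans h')
  · exact ⟨k0, k1, isUnit_frame (ha.1 _) (ha.1 _) h01 h⟩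

/-- Tangent vectors of the rotation orbit are infinitesimal rotations. The rotations moving `a`
along a smooth curve in its orbit are recovered from a frame, hence depend smoothly on time. -/
lemma exists_skew_of_mem_tangentVectors {N : ℕ} (hN : 3 ≤ N) {a w : Config N}
    (ha : a ∈ phaseSpace N) (hw : w ∈ tangentVectors (orbitSO3 a) a) :
    ∃ X : E3 →L[ℝ] E3, (∀ x y, inner ℝ (X x) y = -inner ℝ x (X y)) ∧ w = fun i => X (a i) := by
  obtain ⟨γ, hγs, hγ, hγ0, hγw⟩ := hw
  obtain ⟨i, j, S, hS⟩ := exists_isUnit_frame hN ha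
  set R : ℝ → E3 →L[ℝ] E3 := fun t => frame (γ t i) (γ t j) * ↑S⁻¹ with hR
  have hRg : ∀ t, ∃ g ∈ specialOrthogonalGroup (Fin 3) ℝ, R t = op g ∧ γ t = act g a := by
    intro t
    obtain ⟨g, hg, hgt⟩ := hγ t
    refine ⟨g, hg, ?_, hgt⟩
    rw [hR]
    simp only [hgt, act_apply]
    rw [← op_mul_frame hg, ← hS, mul_assoc, Units.mul_inv, mul_one]
  have hR0 : R 0 = 1 := by
    rw [hR]
    simp only [hγ0, ← hS, Units.mul_inv]
  have hRd : DifferentiableAt ℝ R 0 := by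
    have h : ContDiff ℝ 1 R := by
      have hk : ∀ k, ContDiff ℝ 1 (fun t => γ t k) := fun k =>
        (contDiff_pi.mp (hγs.of_le (by exact_mod_cast le_top)) k)
      exact (contDiff_frame.comp ((hk i).prodMk (hk j))).mul contDiff_const
    exact h.differentiable (by simp) 0
  have hRX : ∀ x, HasDerivAt (fun t => R t x) (deriv R 0 x) 0 := fun x => by
    simpa using hRd.hasDerivAt.clm_apply (hasDerivAt_const (0 : ℝ) x)
  refine ⟨deriv R 0, fun x y => ?_, ?_⟩
  · have h1 := (hRX x).inner ℝ (hRX y)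
    have h2 : (fun t => inner ℝ (R t x) (R t y)) = fun _ => inner ℝ x y := by
      ext t
      obtain ⟨g, hg, hgt, -⟩ := hRg t
      rw [hgt, inner_op, ← op_mul_apply, transpose_mul_self_of_mem_SO3 hg, op_one_apply]
    rw [h2] at h1
    have := h1.unique (hasDerivAt_const _ _)
    simp only [hR0, one_apply_eq_self] at this
    linarith
  · ext1 k
    have h1 := hasDerivAt_pi.mp hγw k
    have h2 : (fun t => γ t k) = fun t => R t (a k) := by
      ext1 t
      obtain ⟨g, hg, hgt, hγt⟩ := hRg t
      rw [hgt, hγt, act_apply]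
    rw [h2] at h1
    exact h1.unique (hRX _)

/-- A rotation between two configurations near `a` is near the identity, so it cannot reverse a
direction. -/
lemma eventually_op_ne_neg {N : ℕ} (hN : 3 ≤ N) {a : Config N} (ha : a ∈ phaseSpace N) :
    ∀ᶠ u : Config N × Config N in 𝓝 (a, a), ∀ k ∈ specialOrthogonalGroup (Fin 3) ℝ,
      act k u.2 = u.1 → ∀ x : E3, x ≠ 0 → op k x ≠ -x := by
  obtain ⟨i, j, S, hS⟩ := exists_isUnit_frame hN ha
  set A : Config N → E3 →L[ℝ] E3 := fun u => frame (u i) (u j) with hA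
  have hAc : Continuous A := continuous_frame (continuous_apply i) (continuous_apply j)
  set B : Config N → E3 →L[ℝ] E3 := fun u => A u * ↑S⁻¹ - 1 with hB
  have hBc : Continuous B := (hAc.mul continuous_const).sub continuous_const
  have hBa : B a = 0 := by rw [hB, hA]; simp only [← hS, Units.mul_inv, sub_self]
  have h1 : ∀ᶠ u : Config N × Config N in 𝓝 (a, a), ‖B u.1‖ + ‖B u.2‖ < 2 := by
    have hc : Continuous (fun u : Config N × Config N => ‖B u.1‖ + ‖B u.2‖) :=
      (hBc.comp continuous_fst).norm.add (hBc.comp continuous_snd).norm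
    refine hc.continuousAt.eventually_lt_const ?_
    simp only [hBa, norm_zero]
    norm_num
  filter_upwards [h1] with u hu k hk hku x hx hkx
  have h2 : op k * A u.2 = A u.1 := by
    rw [hA]; simp only [← hku, act_apply]; exact op_mul_frame hk _ _
  have h3 : -(2 : ℝ) • x = B u.1 x - op k (B u.2 x) := by
    rw [hB]
    simp only [← h2, _root_.sub_apply, mul_apply_eq_comp, one_apply_eq_self, map_sub, hkx]
    module
  have h4 : 2 * ‖x‖ ≤ (‖B u.1‖ + ‖B u.2‖) * ‖x‖ := by
    calc 2 * ‖x‖ = ‖-(2 : ℝ) • x‖ := by simp [norm_smul]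
      _ ≤ ‖B u.1 x‖ + ‖B u.2 x‖ := by
        rw [h3, ← norm_op hk (B u.2 x)]; exact norm_sub_le _ _
      _ ≤ _ := by
        rw [add_mul]
        exact add_le_add (ContinuousLinearMap.le_opNorm _ _) (ContinuousLinearMap.le_opNorm _ _)
  exact absurd (le_of_mul_le_mul_right h4 (norm_pos_iff.mpr hx)) (not_le.mpr hu)

lemma exists_SO3_op_eq_e3 {n : E3} (hn : ‖n‖ = 1) :
    ∃ g ∈ specialOrthogonalGroup (Fin 3) ℝ, op g n = e3 := by
  obtain ⟨b, hb⟩ := Orthonormal.exists_orthonormalBasis_extension_of_card_eq (𝕜 := ℝ)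
    (ι := Fin 3) (E := E3) (by simp) (v := fun _ => n) (s := {2})
    (by
      rw [orthonormal_iff_ite]
      rintro ⟨i, rfl⟩ ⟨j, rfl⟩
      simp [hn])
  have hb2 : b 2 = n := hb 2 rfl
  let M : Matrix (Fin 3) (Fin 3) ℝ := Matrix.of fun i => (b i).ofLp
  have hMM : M * Mᵀ = 1 := by
    ext i j
    have h := orthonormal_iff_ite.mp b.orthonormal j i
    simp only [PiLp.inner_apply, RCLike.inner_apply, conj_trivial] at h
    simp only [M, mul_apply, transpose_apply, of_apply, one_apply]
    rw [h]
    simp [eq_comm]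
  have hdet : M.det * M.det = 1 := by
    have := congrArg Matrix.det hMM
    rwa [det_mul, det_transpose, det_one] at this
  -- A reflection of the first basis vector corrects the orientation.
  let D : Matrix (Fin 3) (Fin 3) ℝ := diagonal ![M.det, 1, 1]
  have hD : D * Dᵀ = 1 := by
    ext i j
    fin_cases i <;> fin_cases j <;> simp [D, hdet]
  refine ⟨D * M, mem_SO3_iff.mpr ⟨?_, ?_⟩, ?_⟩
  · rw [transpose_mul, mul_assoc, ← mul_assoc M, hMM, one_mul, hD]
  · rw [det_mul]; simp [D, hdet, Fin.prod_univ_three]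
  · rw [op_mul_apply]
    have hMn : op M n = e3 := by
      ext i
      have h := orthonormal_iff_ite.mp b.orthonormal i 2
      rw [hb2] at h
      have : (op M n) i = inner ℝ (b i) n := by
        simp [op, M, mulVec, dotProduct, PiLp.inner_apply, mul_comm]
      rw [this, h]
      simp [e3, PiLp.single_apply]
    rw [hMn]
    ext i
    fin_cases i <;> simp [op, D, e3, mulVec_diagonal]

lemma isCompact_SO3 :
    IsCompact (specialOrthogonalGroup (Fin 3) ℝ : Set (Matrix (Fin 3) (Fin 3) ℝ)) := by
  have hK : IsCompact (Set.univ.pi fun _ => Set.univ.pi fun _ => Set.Icc (-1) 1 :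
      Set (Fin 3 → Fin 3 → ℝ)) :=
    isCompact_univ_pi fun _ => isCompact_univ_pi fun _ => isCompact_Icc
  refine IsCompact.of_isClosed_subset (X := Matrix (Fin 3) (Fin 3) ℝ) hK ?_ ?_
  · have : (specialOrthogonalGroup (Fin 3) ℝ : Set (Matrix (Fin 3) (Fin 3) ℝ)) =
        {g | g * gᵀ = 1} ∩ {g | g.det = 1} := by
      ext g; exact mem_SO3_iff
    rw [this]
    exact (isClosed_eq (by fun_prop) continuous_const).inter
      (isClosed_eq (by fun_prop) continuous_const)
  · intro g hg i _ j _
    exact abs_le.mp (entry_norm_bound_of_unitary hg.1 i j)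

lemma isCompact_orbitSO3 {N : ℕ} (a : Config N) : IsCompact (orbitSO3 a) := by
  have : orbitSO3 a = (fun g => act g a) ''
      (specialOrthogonalGroup (Fin 3) ℝ : Set (Matrix (Fin 3) (Fin 3) ℝ)) := by
    ext v
    simp [orbitSO3, eq_comm]
  rw [this]
  refine isCompact_SO3.image (continuous_pi fun i => ?_)
  exact (PiLp.continuous_toLp 2 _).comp (Continuous.matrix_mulVec continuous_id continuous_const)

/-! ### Lyapunov–Schmidt reduction -/

section

variable {N : ℕ} {Γ : Fin N → ℝ} {a : Config N}

lemma eventually_mem_regularSet (ha : a ∈ regularSet N) : ∀ᶠ v in 𝓝 a, v ∈ regularSet N := by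
  have h1 : ∀ᶠ v : Config N in 𝓝 a, ∀ i, v i ≠ 0 :=
    eventually_all.mpr fun i => (continuous_apply i).continuousAt.eventually_ne (ha.1 i)
  have h2 : ∀ᶠ v : Config N in 𝓝 a, ∀ i j, i ≠ j → normalize v i ≠ normalize v j := by
    refine eventually_all.mpr fun i => eventually_all.mpr fun j => ?_
    by_cases hij : i = j
    · exact Eventually.of_forall fun _ h => absurd hij h
    · have hc := (contDiffAt_normalize (n := 1) ha.1).continuousAt
      have hsub : ContinuousAt (fun v => normalize v i - normalize v j) a :=
        ((continuous_apply i).continuousAt.comp hc).sub ((continuous_apply j).continuousAt.comp hc)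
      filter_upwards [hsub.eventually_ne (sub_ne_zero.mpr fun h => hij (ha.2 h))] with v hv _
      exact sub_ne_zero.mp hv
  filter_upwards [h1, h2] with v hv1 hv2
  exact ⟨hv1, fun i j h => by_contra fun hij => hv2 i j hij h⟩

lemma fderiv_augmented {v : Config N} (hv : v ∈ regularSet N) (ξ : E3) :
    fderiv ℝ (augmented Γ ξ) v = fderiv ℝ (radialExt (hamiltonian Γ)) v -
      (innerSL ℝ ξ).comp (fderiv ℝ (fun w => momentum Γ (normalize w)) v) := by
  have h1 := ((contDiffAt_radialExt (Γ := Γ) (n := 1) hv).differentiableAt (by simp)).hasFDerivAt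
  have h2 := ((contDiffAt_momentum_normalize (Γ := Γ) (n := 1) hv.1).differentiableAt
    (by simp)).hasFDerivAt
  have h3 := h1.sub ((innerSL ℝ ξ).hasFDerivAt.comp v h2)
  have h4 : augmented Γ ξ = radialExt (hamiltonian Γ) -
      (innerSL ℝ ξ) ∘ (fun w => momentum Γ (normalize w)) := by
    ext w
    simp [augmented, real_inner_comm]
  rw [h4]
  exact h3.fderiv

lemma isInvertible_of_nondegenerate {E : Type*} [NormedAddCommGroup E] [NormedSpace ℝ E]
    [FiniteDimensional ℝ E] (L : E →L[ℝ] E →L[ℝ] ℝ) (hL : ∀ w, L w = 0 → w = 0) :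
    L.IsInvertible := by
  let L₁ : E →ₗ[ℝ] Module.Dual ℝ E :=
    { toFun := fun w => (L w).toLinearMap
      map_add' := fun x y => by simp
      map_smul' := fun c x => by simp }
  have hinj : Function.Injective L₁ := by
    refine (injective_iff_map_eq_zero L₁).mpr fun w hw => hL w ?_
    ext1 w'
    exact LinearMap.congr_fun hw w'
  have hsurj := (LinearMap.injective_iff_surjective_of_finrank_eq_finrank
    (Subspace.dual_finrank_eq (K := ℝ) (V := E)).symm).mp hinj
  have hker : (L : E →ₗ[ℝ] E →L[ℝ] ℝ).ker = ⊥ := (Submodule.eq_bot_iff _).mpr hL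
  have hrange : (L : E →ₗ[ℝ] E →L[ℝ] ℝ).range = ⊤ := by
    refine Submodule.eq_top_iff'.mpr fun T => ?_
    obtain ⟨w, hw⟩ := hsurj T.toLinearMap
    exact ⟨w, ContinuousLinearMap.ext fun w' => LinearMap.congr_fun hw w'⟩
  have : CompleteSpace E := FiniteDimensional.complete ℝ E
  exact ⟨ContinuousLinearEquiv.ofBijective L hker hrange, by ext; rfl⟩

/-- If the Hessian of the Hamiltonian at the critical point `a` is nondegenerate on `W`, then the
equations for critical points of the augmented Hamiltonian in the directions of `W` can be solved
in `a + W`, with a solution depending smoothly on the angular velocity vector. -/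
theorem exists_reduction (ha : a ∈ regularSet N) (W : Submodule ℝ (Config N))
    (hcrit : ∀ w ∈ W, fderiv ℝ (radialExt (hamiltonian Γ)) a w = 0)
    (hW : ∀ w ∈ W, (∀ w' ∈ W, hessian (hamiltonian Γ) a w w' = 0) → w = 0) :
    ∃ u : E3 → Config N, ContDiffAt ℝ 1 u 0 ∧ u 0 = a ∧ (∀ ξ, u ξ - a ∈ W) ∧
      ∀ᶠ ξ in 𝓝 0, ∀ w ∈ W, fderiv ℝ (augmented Γ ξ) (u ξ) w = 0 := by
  set f := radialExt (hamiltonian Γ) with hf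
  set m : Config N → E3 := fun w => momentum Γ (normalize w) with hm
  -- The derivative along `W` at `a + w`, as a function of `(ξ, w)`.
  set G : E3 × W → (W →L[ℝ] ℝ) := fun x =>
    (fderiv ℝ f (a + x.2) - (innerSL ℝ x.1).comp (fderiv ℝ m (a + x.2))).comp W.subtypeL with hG
  have hf1 : ContDiffAt ℝ 1 (fderiv ℝ f) a :=
    (contDiffAt_radialExt (n := 2) ha).fderiv_right (by norm_num)
  have hm1 : ContDiffAt ℝ 1 (fderiv ℝ m) a :=
    (contDiffAt_momentum_normalize (n := 2) ha.1).fderiv_right (by norm_num)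
  have hadd : ContDiffAt ℝ 1 (fun x : E3 × W => a + (x.2 : Config N)) 0 :=
    contDiffAt_const.add (W.subtypeL.contDiff.comp contDiff_snd).contDiffAt
  have ha0 : a + (((0 : E3 × W).2 : W) : Config N) = a := by simp
  have hGd : ContDiffAt ℝ 1 G 0 := by
    have h1 : ContDiffAt ℝ 1 (fun x : E3 × W => fderiv ℝ f (a + x.2)) 0 :=
      ContDiffAt.comp (g := fderiv ℝ f) 0 (by rwa [ha0]) hadd
    have h2 : ContDiffAt ℝ 1 (fun x : E3 × W => fderiv ℝ m (a + x.2)) 0 :=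
      ContDiffAt.comp (g := fderiv ℝ m) 0 (by rwa [ha0]) hadd
    have h3 : ContDiffAt ℝ 1 (fun x : E3 × W => innerSL ℝ x.1) 0 :=
      ((innerSL ℝ (E := E3)).contDiff.comp contDiff_fst).contDiffAt
    exact (h1.sub (h3.clm_comp h2)).clm_comp contDiffAt_const
  have hGinr : ∀ w w' : W, fderiv ℝ G 0 (0, w) w' = hessian (hamiltonian Γ) a w w' := by
    intro w w'
    have h1 : HasFDerivAt (fun w : W => G (0, w))
        ((fderiv ℝ G 0).comp (ContinuousLinearMap.inr ℝ E3 W)) 0 :=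
      HasFDerivAt.comp (g := G) (0 : W) (hGd.differentiableAt (by simp)).hasFDerivAt
        (ContinuousLinearMap.inr ℝ E3 W).hasFDerivAt
    have h2 : HasFDerivAt (fun w : W => fderiv ℝ f (a + w))
        ((fderiv ℝ (fderiv ℝ f) a).comp W.subtypeL) 0 := by
      refine HasFDerivAt.comp (g := fderiv ℝ f) (f := fun w : W => a + (w : Config N)) (0 : W) ?_
        (W.subtypeL.hasFDerivAt.const_add a)
      simpa using (hf1.differentiableAt (by simp)).hasFDerivAt
    have h3 : (fun w : W => G (0, w)) = fun w : W => (fderiv ℝ f (a + w)).comp W.subtypeL := by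
      ext w w'
      simp [hG]
    rw [h3] at h1
    have h4 := h2.clm_comp (hasFDerivAt_const W.subtypeL (0 : W))
    have h5 := congrArg (fun L => L w w') (h1.unique h4)
    simpa [hessian] using h5
  have hinv : (fderiv ℝ G 0 ∘SL ContinuousLinearMap.inr ℝ E3 W).IsInvertible := by
    set L := fderiv ℝ G 0 ∘SL ContinuousLinearMap.inr ℝ E3 W with hL
    have hker : ∀ w, L w = 0 → w = 0 := by
      intro w hw
      have : (w : Config N) = 0 := hW w w.2 fun w' hw' => by
        rw [← hGinr w ⟨w', hw'⟩]
        exact congrArg (fun T : W →L[ℝ] ℝ => T ⟨w', hw'⟩) hw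
      exact_mod_cast this
    exact isInvertible_of_nondegenerate L hker
  set ψ := hGd.implicitFunction (by simp) hinv with hψ
  have hψ0 : ψ 0 = 0 := hGd.implicitFunction_apply_self (by simp) hinv
  have hψd : ContDiffAt ℝ 1 ψ 0 := hGd.contDiffAt_implicitFunction (by simp) hinv
  have hu : ContDiffAt ℝ 1 (fun ξ => a + (ψ ξ : Config N)) 0 :=
    contDiffAt_const.add (W.subtypeL.contDiff.contDiffAt.comp 0 hψd)
  refine ⟨fun ξ => a + (ψ ξ : Config N), hu, by simp [hψ0], fun ξ => by simp, ?_⟩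
  have hreg : ∀ᶠ ξ in 𝓝 (0 : E3), a + (ψ ξ : Config N) ∈ regularSet N := by
    refine hu.continuousAt.eventually ?_
    simpa [hψ0] using eventually_mem_regularSet ha
  have hG0 : G 0 = 0 := by
    ext w
    simp [hG, hcrit w w.2]
  filter_upwards [hreg, hGd.eventually_apply_implicitFunction (by simp) hinv] with ξ h1 h2 w hw
  rw [fderiv_augmented h1]
  rw [hG0] at h2
  exact congrArg (fun T : W →L[ℝ] ℝ => T ⟨w, hw⟩) h2

/-- If `W`, the radial directions and the infinitesimal rotations span at `a`, then they span at
nearby configurations; this is phrased through linear functionals. -/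
lemma eventually_eq_zero_of_span (W : Submodule ℝ (Config N))
    (hspan : ∀ x : Config N, ∃ w ∈ W, ∃ (r : Fin N → ℝ) (X : E3 →L[ℝ] E3),
      (∀ y z, inner ℝ (X y) z = -inner ℝ y (X z)) ∧ x = w + fun i => r i • a i + X (a i)) :
    ∀ᶠ v in 𝓝 a, ∀ l : Config N →L[ℝ] ℝ, (∀ w ∈ W, l w = 0) →
      (∀ r : Fin N → ℝ, l (fun i => r i • v i) = 0) →
      (∀ X : E3 →L[ℝ] E3, (∀ y z, inner ℝ (X y) z = -inner ℝ y (X z)) →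
        l (fun i => X (v i)) = 0) → l = 0 := by
  let S : Submodule ℝ (E3 →L[ℝ] E3) :=
    { carrier := {X | ∀ y z, inner ℝ (X y) z = -inner ℝ y (X z)}
      add_mem' := by
        intro X Y hX hY y z
        simp [inner_add_left, inner_add_right, hX y z, hY y z]
        ring
      zero_mem' := by intro y z; simp
      smul_mem' := by
        intro c X hX y z
        simp [inner_smul_left, inner_smul_right, hX y z] }
  let T : (W × (Fin N → ℝ) × S) →ₗ[ℝ] Config N :=
    { toFun := fun p => (p.1 : Config N) + fun i => p.2.1 i • a i + (p.2.2 : E3 →L[ℝ] E3) (a i)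
      map_add' := by
        intro p q; ext1 i
        simp
        module
      map_smul' := by
        intro c p; ext1 i
        simp [smul_smul] }
  have hT : Function.Surjective T := by
    intro x
    obtain ⟨w, hw, r, X, hX, hx⟩ := hspan x
    exact ⟨(⟨w, hw⟩, r, ⟨X, hX⟩), hx.symm⟩
  obtain ⟨R, hR⟩ := T.exists_rightInverse_of_surjective (LinearMap.range_eq_top.mpr hT)
  let B : Config N →ₗ[ℝ] Config N →ₗ[ℝ] Config N := LinearMap.mk₂ ℝ
    (fun v x => fun i => (R x).2.1 i • v i + ((R x).2.2 : E3 →L[ℝ] E3) (v i))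
    (by intro v v' x; ext1 i; simp; module)
    (by intro c v x; ext1 i; simp; module)
    (by intro v x x'; ext1 i; simp; module)
    (by intro c v x; ext1 i; simp [smul_smul])
  -- `M v` sends `x` to the combination at `v` with the coefficients that represent `x` at `a`.
  let M : Config N → Config N →L[ℝ] Config N := fun v =>
    1 + LinearMap.toContinuousLinearMap (B (v - a))
  have hMc : Continuous M := by
    have h : Continuous ((LinearMap.toContinuousLinearMap (𝕜 := ℝ) (E := Config N)
        (F' := Config N)).toLinearMap ∘ₗ B) := LinearMap.continuous_of_finiteDimensional _
    exact continuous_const.add (h.comp (continuous_id.sub continuous_const))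
  have hM : ∀ v x, M v x = (R x).1 + fun i => (R x).2.1 i • v i +
      ((R x).2.2 : E3 →L[ℝ] E3) (v i) := by
    intro v x
    have h1 : ((R x).1 : Config N) + B a x = x := LinearMap.congr_fun hR x
    have h2 : M v x = x + (B v x - B a x) := by
      simp [M, map_sub]
    rw [h2]
    nth_rewrite 1 [← h1]
    simp [B]
  have hMa : IsUnit (M a) := by simp [M]
  have hU : ∀ᶠ v in 𝓝 a, IsUnit (M v) :=
    hMc.continuousAt.eventually (Units.isOpen.mem_nhds hMa)
  filter_upwards [hU] with v hv l hW hr hX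
  ext1 x
  obtain ⟨U, hU⟩ := hv
  have hx : x = M v ((↑U⁻¹ : Config N →L[ℝ] Config N) x) := by
    rw [← hU, ← mul_apply_eq_comp]; simp
  set y := (↑U⁻¹ : Config N →L[ℝ] Config N) x
  have hsplit : x = ((R y).1 : Config N) + ((fun i => (R y).2.1 i • v i) +
      fun i => ((R y).2.2 : E3 →L[ℝ] E3) (v i)) := hx.trans (hM v y)
  rw [hsplit, map_add, map_add, hW _ (R y).1.2, hr, hX _ (R y).2.2.2]
  simp

/-- A complement of the null-space of the Hessian in the tangent space: the Hessian is
nondegenerate on it, and together with the radial directions and the infinitesimal rotations it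
spans everything. -/
lemma exists_slice (hN : 3 ≤ N) (ha : a ∈ phaseSpace N)
    (hker : hessianKer (hamiltonian Γ) a = tangentVectors (orbitSO3 a) a) :
    ∃ W : Submodule ℝ (Config N), W ≤ tangentM a ∧
      (∀ w ∈ W, (∀ w' ∈ W, hessian (hamiltonian Γ) a w w' = 0) → w = 0) ∧
      ∀ x : Config N, ∃ w ∈ W, ∃ (r : Fin N → ℝ) (X : E3 →L[ℝ] E3),
        (∀ y z, inner ℝ (X y) z = -inner ℝ y (X z)) ∧ x = w + fun i => r i • a i + X (a i) := by
  let K : Submodule ℝ (Config N) :=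
    { carrier := hessianKer (hamiltonian Γ) a
      add_mem' := by
        rintro x y ⟨hx, hx'⟩ ⟨hy, hy'⟩
        refine ⟨add_mem hx hy, fun w hw => ?_⟩
        have h1 := hx' w hw
        have h2 := hy' w hw
        simp only [hessian] at h1 h2 ⊢
        simp [h1, h2]
      zero_mem' := ⟨zero_mem _, fun w hw => by simp [hessian]⟩
      smul_mem' := by
        rintro c x ⟨hx, hx'⟩
        refine ⟨Submodule.smul_mem _ c hx, fun w hw => ?_⟩
        have h1 := hx' w hw
        simp only [hessian] at h1 ⊢
        simp [h1] }
  have hKT : K ≤ tangentM a := fun x hx => hx.1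
  obtain ⟨C, hC⟩ := Submodule.exists_isCompl K
  have hdec : ∀ t ∈ tangentM a, ∃ k ∈ K, ∃ w ∈ C ⊓ tangentM a, k + w = t := by
    intro t ht
    obtain ⟨k, hk, c, hc, rfl⟩ := Submodule.mem_sup.mp
      (show t ∈ K ⊔ C by rw [hC.sup_eq_top]; trivial)
    refine ⟨k, hk, c, ⟨hc, ?_⟩, rfl⟩
    simpa using sub_mem ht (hKT hk)
  have hsymm : ∀ x y, hessian (hamiltonian Γ) a x y = hessian (hamiltonian Γ) a y x := fun x y =>
    ((contDiffAt_radialExt (n := 2) (phaseSpace_subset_regularSet ha)).isSymmSndFDerivAt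
      (by simp)).eq x y
  refine ⟨C ⊓ tangentM a, inf_le_right, fun w hw hww => ?_, fun x => ?_⟩
  · have hwK : w ∈ K := by
      refine ⟨hw.2, fun t ht => ?_⟩
      obtain ⟨k, hk, w', hw', rfl⟩ := hdec t ht
      have h1 : hessian (hamiltonian Γ) a w k = 0 := by rw [hsymm]; exact hk.2 w hw.2
      have h2 := hww w' hw'
      simp only [hessian] at h1 h2 ⊢
      rw [map_add, h1, h2, add_zero]
    have : w ∈ K ⊓ C := ⟨hwK, hw.1⟩
    rw [hC.inf_eq_bot] at this
    exact (Submodule.mem_bot ℝ).mp this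
  · set t : Config N := fun i => x i - (inner ℝ (a i) (x i) : ℝ) • a i with ht
    have htT : t ∈ tangentM a := by
      intro i
      simp [ht, inner_sub_right, inner_smul_right, ha.1 i]
    obtain ⟨k, hk, w, hw, hkw⟩ := hdec t htT
    have hk' : k ∈ tangentVectors (orbitSO3 a) a := by rw [← hker]; exact hk
    obtain ⟨X, hX, hkX⟩ := exists_skew_of_mem_tangentVectors hN ha hk'
    refine ⟨w, hw, fun i => inner ℝ (a i) (x i), X, hX, ?_⟩
    ext1 i
    have h : X (a i) + w i = x i - (inner ℝ (a i) (x i) : ℝ) • a i := by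
      rw [hkX] at hkw; exact congrFun hkw i
    rw [Pi.add_apply, add_left_comm, add_comm (w i), h, add_sub_cancel]

end

/-! ### Critical points of the reduced function -/

section

variable {N : ℕ} {Γ : Fin N → ℝ} {a : Config N} {u : E3 → Config N}

lemma augmented_normalize {ξ : E3} {v : Config N} (hv : ∀ i, v i ≠ 0) :
    augmented Γ ξ (normalize v) = augmented Γ ξ v := by
  rw [← augmented_smul (fun i => norm_pos_iff.mpr (hv i)) (normalize v)]
  congr 1
  ext1 i
  simp [normalize, smul_smul, mul_inv_cancel₀ (norm_ne_zero_iff.mpr (hv i))]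

/-- The derivative of the reduced function `ξ ↦ augmented Γ ξ (u ξ)` is minus the momentum, since
`u ξ` is critical in the directions in which it moves. -/
lemma hasDerivAt_reduced {W : Submodule ℝ (Config N)} (huW : ∀ ξ, u ξ - a ∈ W) {ξ τ : E3}
    (hu : DifferentiableAt ℝ u ξ) (hreg : u ξ ∈ regularSet N)
    (hcrit : ∀ w ∈ W, fderiv ℝ (augmented Γ ξ) (u ξ) w = 0)
    {c : ℝ → E3} (hc0 : c 0 = ξ) (hc : HasDerivAt c τ 0) :
    HasDerivAt (fun t => augmented Γ (c t) (u (c t)))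
      (-inner ℝ (momentum Γ (normalize (u ξ))) τ) 0 := by
  subst hc0
  have huc : HasDerivAt (fun t => u (c t)) (fderiv ℝ u (c 0) τ) 0 :=
    hu.hasFDerivAt.comp_hasDerivAt (0 : ℝ) hc
  -- `u` takes values in the closed affine subspace `a + W`, so its difference quotients lie in `W`.
  have hW : fderiv ℝ u (c 0) τ ∈ W := by
    have hl : HasDerivAt (fun t : ℝ => c 0 + t • τ) τ 0 := by
      simpa using ((hasDerivAt_id (0 : ℝ)).smul_const τ).const_add (c 0)
    have hul : HasDerivAt (fun t : ℝ => u (c 0 + t • τ) - a) (fderiv ℝ u (c 0) τ) 0 := by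
      refine HasDerivAt.sub_const a (HasFDerivAt.comp_hasDerivAt (0 : ℝ) (l := u) ?_ hl)
      simpa using hu.hasFDerivAt
    have hcl : IsClosed (W : Set (Config N)) := W.closed_of_finiteDimensional
    refine hcl.mem_of_tendsto (hasDerivAt_iff_tendsto_slope_zero.mp hul)
      (Eventually.of_forall fun t => ?_)
    exact W.smul_mem _ (W.sub_mem (huW _) (huW _))
  have hH := ((contDiffAt_radialExt (Γ := Γ) (n := 1) hreg).differentiableAt
    (by simp)).hasFDerivAt.comp_hasDerivAt (0 : ℝ) huc
  have hm := ((contDiffAt_momentum_normalize (Γ := Γ) (n := 1) hreg.1).differentiableAt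
    (by simp)).hasFDerivAt.comp_hasDerivAt (0 : ℝ) huc
  have h0 := hcrit _ hW
  rw [fderiv_augmented hreg] at h0
  convert! hH.sub (hm.inner ℝ hc) using 1
  simp only [_root_.sub_apply, ContinuousLinearMap.comp_apply, innerSL_apply_apply] at h0
  rw [real_inner_comm] at h0
  simp only [Function.comp_apply]
  linarith

/-- If `ξ` maximises or minimises the reduced function among vectors of the same length, then
`u ξ` is critical: along infinitesimal rotations the two derivatives agree. -/
lemma hasFDerivAt_of_extremal {W : Submodule ℝ (Config N)} (huW : ∀ ξ, u ξ - a ∈ W) {ξ : E3}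
    (hu : DifferentiableAt ℝ u ξ) (hreg : u ξ ∈ regularSet N)
    (hcrit : ∀ w ∈ W, fderiv ℝ (augmented Γ ξ) (u ξ) w = 0)
    (hspan : ∀ l : Config N →L[ℝ] ℝ, (∀ w ∈ W, l w = 0) →
      (∀ r : Fin N → ℝ, l (fun i => r i • u ξ i) = 0) →
      (∀ X : E3 →L[ℝ] E3, (∀ y z, inner ℝ (X y) z = -inner ℝ y (X z)) →
        l (fun i => X (u ξ i)) = 0) → l = 0)
    (hext : (∀ η, ‖η‖ = ‖ξ‖ → augmented Γ η (u η) ≤ augmented Γ ξ (u ξ)) ∨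
      (∀ η, ‖η‖ = ‖ξ‖ → augmented Γ ξ (u ξ) ≤ augmented Γ η (u η))) :
    HasFDerivAt (augmented Γ ξ) (0 : Config N →L[ℝ] ℝ) (u ξ) := by
  have hd : fderiv ℝ (augmented Γ ξ) (u ξ) = 0 := by
    refine hspan _ hcrit (fun r => fderiv_augmented_radial hreg r) fun X hX => ?_
    have hc0 := exp_zero_smul_apply X ξ
    have h := hasDerivAt_reduced huW hu hreg hcrit hc0 (hasDerivAt_exp_smul_apply X ξ)
    have h0 : -inner ℝ (momentum Γ (normalize (u ξ))) (X ξ) = 0 := by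
      rcases hext with hext | hext
      · refine IsLocalMax.hasDerivAt_eq_zero (Eventually.of_forall fun t => ?_) h
        simp only [hc0]
        exact hext _ (norm_exp_smul_apply hX t ξ)
      · refine IsLocalMin.hasDerivAt_eq_zero (Eventually.of_forall fun t => ?_) h
        simp only [hc0]
        exact hext _ (norm_exp_smul_apply hX t ξ)
    rw [fderiv_augmented_skew hreg hX]
    linarith
  rw [← hd]
  exact ((contDiffAt_augmented (n := 1) hreg).differentiableAt (by simp)).hasFDerivAt

/-- A continuous function on the unit sphere has a maximiser `n₁` and a minimiser `n₂` which are
either separated by their values or antipodal. -/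
lemma exists_extremal_pair {f : E3 → ℝ} (hf : ContinuousOn f (Metric.sphere 0 1)) :
    ∃ n₁ n₂ : E3, ‖n₁‖ = 1 ∧ ‖n₂‖ = 1 ∧ (∀ n, ‖n‖ = 1 → f n ≤ f n₁) ∧
      (∀ n, ‖n‖ = 1 → f n₂ ≤ f n) ∧ (f n₁ ≠ f n₂ ∨ n₂ = -n₁) := by
  have he : ‖e3‖ = 1 := by simp [e3]
  have hne : (Metric.sphere (0 : E3) 1).Nonempty := ⟨e3, by simp [he]⟩
  obtain ⟨n₁, h₁, hmax⟩ := (isCompact_sphere (0 : E3) 1).exists_isMaxOn hne hf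
  obtain ⟨n₂, h₂, hmin⟩ := (isCompact_sphere (0 : E3) 1).exists_isMinOn hne hf
  have hM : ∀ n, ‖n‖ = 1 → f n ≤ f n₁ := fun n hn => hmax (by simpa using hn)
  have hm : ∀ n, ‖n‖ = 1 → f n₂ ≤ f n := fun n hn => hmin (by simpa using hn)
  by_cases h : f n₁ = f n₂
  · -- The function is constant, so any antipodal pair will do.
    refine ⟨e3, -e3, he, by rw [norm_neg, he], fun n hn => ?_, fun n hn => ?_, Or.inr rfl⟩
    · exact (hM n hn).trans (h.trans_le (hm _ he))
    · exact (hM _ (by rw [norm_neg, he])).trans (h.trans_le (hm n hn))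
  · exact ⟨n₁, n₂, by simpa using h₁, by simpa using h₂, hM, hm, Or.inl h⟩

/-- Relative equilibria obtained by rotating `u₁` and `u₂` lie on different `SO(2)`-orbits if
their augmented energies differ, or if they come from antipodal directions and `u₁`, `u₂` are
not related by a rotation reversing these. -/
lemma orbitSO2_ne {n₁ n₂ : E3} {g₁ g₂ : Matrix (Fin 3) (Fin 3) ℝ} {u₁ u₂ : Config N} {ω : ℝ}
    (hn₁ : ‖n₁‖ = 1)
    (hg₁ : g₁ ∈ specialOrthogonalGroup (Fin 3) ℝ) (hg₂ : g₂ ∈ specialOrthogonalGroup (Fin 3) ℝ)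
    (h₁ : op g₁ n₁ = e3) (h₂ : op g₂ n₂ = e3)
    (hne : augmented Γ (ω • n₁) u₁ ≠ augmented Γ (ω • n₂) u₂ ∨ n₂ = -n₁)
    (hop : ∀ k ∈ specialOrthogonalGroup (Fin 3) ℝ, act k u₂ = u₁ → ∀ x : E3, x ≠ 0 → op k x ≠ -x) :
    orbitSO2 (act g₁ u₁) ≠ orbitSO2 (act g₂ u₂) := by
  intro heq
  have hmem : act g₁ u₁ ∈ orbitSO2 (act g₁ u₁) :=
    ⟨0, by rw [show rotZ 0 = 1 by ext i j; fin_cases i <;> fin_cases j <;> simp [rotZ], act_one]⟩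
  rw [heq] at hmem
  obtain ⟨θ, hθ⟩ := hmem
  rcases hne with hne | hne
  · have e₁ : augmented Γ (ω • e3) (act g₁ u₁) = augmented Γ (ω • n₁) u₁ := by
      rw [← h₁, ← map_smul, augmented_act hg₁]
    have e₂ : augmented Γ (ω • e3) (act g₂ u₂) = augmented Γ (ω • n₂) u₂ := by
      rw [← h₂, ← map_smul, augmented_act hg₂]
    have e₃ := augmented_act (Γ := Γ) (rotZ_mem_SO3 θ) (ω • e3) (act g₂ u₂)
    rw [map_smul, op_rotZ_e3, ← hθ] at e₃
    exact hne (by rw [← e₁, e₃, e₂])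
  · have hk : g₁ᵀ * (rotZ θ * g₂) ∈ specialOrthogonalGroup (Fin 3) ℝ :=
      mul_mem (transpose_mem_SO3 hg₁) (mul_mem (rotZ_mem_SO3 θ) hg₂)
    have hku : act (g₁ᵀ * (rotZ θ * g₂)) u₂ = u₁ := by
      rw [← act_act, ← act_act, ← hθ, act_act, transpose_mul_self_of_mem_SO3 hg₁, act_one]
    have hx : op (g₁ᵀ * (rotZ θ * g₂)) n₂ = -n₂ := by
      rw [op_mul_apply, op_mul_apply, h₂, op_rotZ_e3, ← h₁, ← op_mul_apply,
        transpose_mul_self_of_mem_SO3 hg₁, op_one_apply, hne, neg_neg]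
    refine hop _ hk hku n₂ ?_ hx
    rw [hne, neg_ne_zero]
    exact norm_ne_zero_iff.mp (by simp [hn₁])

/-- Relative equilibria for all small angular velocities: rotated values of a map `y` which is
continuous at `0` with value `a`. -/
theorem exists_relativeEquilibria (hN : 3 ≤ N) (hΓ : ∀ i, Γ i ≠ 0) (ha : a ∈ phaseSpace N)
    (hcrit : ∀ w ∈ tangentM a, fderiv ℝ (radialExt (hamiltonian Γ)) a w = 0)
    (hker : hessianKer (hamiltonian Γ) a = tangentVectors (orbitSO3 a) a) :
    ∃ y : E3 → Config N, Tendsto y (𝓝 0) (𝓝 a) ∧ ∃ ω₀ : ℝ, 0 < ω₀ ∧ ∀ ω : ℝ, |ω| < ω₀ →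
      ∃ n₁ n₂ : E3, ∃ g₁ ∈ specialOrthogonalGroup (Fin 3) ℝ,
        ∃ g₂ ∈ specialOrthogonalGroup (Fin 3) ℝ, ‖n₁‖ = 1 ∧ ‖n₂‖ = 1 ∧
        IsRelativeEquilibrium Γ (act g₁ (y (ω • n₁))) ω ∧
        IsRelativeEquilibrium Γ (act g₂ (y (ω • n₂))) ω ∧
        orbitSO2 (act g₁ (y (ω • n₁))) ≠ orbitSO2 (act g₂ (y (ω • n₂))) := by
  have hreg := phaseSpace_subset_regularSet ha
  obtain ⟨W, hWT, hWnd, hWspan⟩ := exists_slice hN ha hker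
  obtain ⟨u, hu, hu0, huW, hucrit⟩ :=
    exists_reduction hreg W (fun w hw => hcrit w (hWT hw)) hWnd
  have hut : Tendsto u (𝓝 0) (𝓝 a) := by simpa [hu0] using hu.continuousAt.tendsto
  have hyt : Tendsto (fun ξ => normalize (u ξ)) (𝓝 0) (𝓝 a) := by
    have h := (contDiffAt_normalize (n := 1) hreg.1).continuousAt.tendsto
    rw [normalize_of_unit ha.1] at h
    exact h.comp hut
  have hgood : ∀ᶠ ξ in 𝓝 (0 : E3), DifferentiableAt ℝ u ξ ∧ u ξ ∈ regularSet N ∧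
      (∀ w ∈ W, fderiv ℝ (augmented Γ ξ) (u ξ) w = 0) ∧
      ∀ l : Config N →L[ℝ] ℝ, (∀ w ∈ W, l w = 0) →
        (∀ r : Fin N → ℝ, l (fun i => r i • u ξ i) = 0) →
        (∀ X : E3 →L[ℝ] E3, (∀ y z, inner ℝ (X y) z = -inner ℝ y (X z)) →
          l (fun i => X (u ξ i)) = 0) → l = 0 := by
    filter_upwards [hu.eventually (by simp), hut.eventually (eventually_mem_regularSet hreg),
      hucrit, hut.eventually (eventually_eq_zero_of_span W hWspan)] with ξ h1 h2 h3 h4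
    exact ⟨h1.differentiableAt (by simp), h2, h3, h4⟩
  obtain ⟨δ₁, hδ₁, hball₁⟩ := Metric.eventually_nhds_iff.mp hgood
  have hfar : ∀ᶠ p : E3 × E3 in 𝓝 (0, 0), ∀ k ∈ specialOrthogonalGroup (Fin 3) ℝ,
      act k (normalize (u p.2)) = normalize (u p.1) → ∀ x : E3, x ≠ 0 → op k x ≠ -x := by
    rw [nhds_prod_eq]
    have h := eventually_op_ne_neg hN ha
    rw [nhds_prod_eq] at h
    exact (hyt.prodMap hyt).eventually h
  obtain ⟨δ₂, hδ₂, hball₂⟩ := Metric.eventually_nhds_iff.mp hfar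
  refine ⟨fun ξ => normalize (u ξ), hyt, min δ₁ δ₂, lt_min hδ₁ hδ₂, fun ω hω => ?_⟩
  have hnorm : ∀ n : E3, ‖n‖ = 1 → ‖ω • n‖ = |ω| := fun n hn => by simp [norm_smul, hn]
  have hin : ∀ n : E3, ‖n‖ = 1 → dist (ω • n) 0 < min δ₁ δ₂ := fun n hn => by
    rwa [dist_zero_right, hnorm n hn]
  set f : E3 → ℝ := fun n => augmented Γ (ω • n) (u (ω • n)) with hf
  have hfc : ContinuousOn f (Metric.sphere 0 1) := by
    intro n hn
    obtain ⟨h1, h2, -, -⟩ := hball₁ ((hin n (by simpa using hn)).trans_le (min_le_left _ _))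
    refine ContinuousAt.continuousWithinAt ?_
    have hs : ContinuousAt (fun n : E3 => ω • n) n := by fun_prop
    have hus : ContinuousAt (fun n : E3 => u (ω • n)) n :=
      ContinuousAt.comp (g := u) h1.continuousAt hs
    have hH : ContinuousAt (fun n : E3 => radialExt (hamiltonian Γ) (u (ω • n))) n :=
      ContinuousAt.comp (g := radialExt (hamiltonian Γ))
        (contDiffAt_radialExt (n := 1) h2).continuousAt hus
    have hm : ContinuousAt (fun n : E3 => momentum Γ (normalize (u (ω • n)))) n :=
      ContinuousAt.comp (g := fun w => momentum Γ (normalize w))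
        (contDiffAt_momentum_normalize (n := 1) h2.1).continuousAt hus
    exact hH.sub (hm.inner hs)
  obtain ⟨n₁, n₂, hn₁, hn₂, hmax, hmin, hne⟩ := exists_extremal_pair hfc
  -- Any vector of length `|ω|` is `ω` times a unit vector.
  have hscale : ∀ n η : E3, ‖n‖ = 1 → ‖η‖ = ‖ω • n‖ → ∃ n', ‖n'‖ = 1 ∧ η = ω • n' := by
    intro n η hn hη
    rw [hnorm n hn] at hη
    by_cases h0 : ω = 0
    · exact ⟨n, hn, by simpa [h0] using hη⟩
    · refine ⟨ω⁻¹ • η, ?_, by rw [smul_smul, mul_inv_cancel₀ h0, one_smul]⟩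
      rw [norm_smul, hη, norm_inv, Real.norm_eq_abs, inv_mul_cancel₀ (abs_ne_zero.mpr h0)]
  have hrel : ∀ n g, ‖n‖ = 1 → g ∈ specialOrthogonalGroup (Fin 3) ℝ → op g n = e3 →
      ((∀ n', ‖n'‖ = 1 → f n' ≤ f n) ∨ (∀ n', ‖n'‖ = 1 → f n ≤ f n')) →
      IsRelativeEquilibrium Γ (act g (normalize (u (ω • n)))) ω := by
    intro n g hn hg hgn hext
    obtain ⟨h1, h2, h3, h4⟩ := hball₁ ((hin n hn).trans_le (min_le_left _ _))
    have h5 : HasFDerivAt (augmented Γ (ω • n)) (0 : Config N →L[ℝ] ℝ) (u (ω • n)) := by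
      refine hasFDerivAt_of_extremal huW h1 h2 h3 h4 (hext.imp (fun h η hη => ?_) fun h η hη => ?_)
      all_goals
        obtain ⟨n', hn', rfl⟩ := hscale n η hn hη
        exact h n' hn'
    have h6 := hasFDerivAt_augmented_act hg (hasFDerivAt_augmented_normalize h2.1 h5)
    rw [map_smul, hgn] at h6
    exact isRelativeEquilibrium_of_critical hΓ
      (act_mem_phaseSpace hg (normalize_mem_phaseSpace h2)) h6
  obtain ⟨g₁, hg₁, hgn₁⟩ := exists_SO3_op_eq_e3 hn₁
  obtain ⟨g₂, hg₂, hgn₂⟩ := exists_SO3_op_eq_e3 hn₂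
  refine ⟨n₁, n₂, g₁, hg₁, g₂, hg₂, hn₁, hn₂, hrel n₁ g₁ hn₁ hg₁ hgn₁ (Or.inl hmax),
    hrel n₂ g₂ hn₂ hg₂ hgn₂ (Or.inr hmin),
    orbitSO2_ne (Γ := Γ) (ω := ω) hn₁ hg₁ hg₂ hgn₁ hgn₂ ?_ ?_⟩
  · have hy : ∀ n : E3, ‖n‖ = 1 → augmented Γ (ω • n) (normalize (u (ω • n))) = f n := by
      intro n hn
      exact augmented_normalize (hball₁ ((hin n hn).trans_le (min_le_left _ _))).2.1.1
    rwa [hy n₁ hn₁, hy n₂ hn₂]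
  · refine hball₂ (y := (ω • n₁, ω • n₂)) ?_
    rw [Prod.dist_eq]
    exact (max_lt (hin n₁ hn₁) (hin n₂ hn₂)).trans_le (min_le_right _ _)

lemma dist_act {g : Matrix (Fin 3) (Fin 3) ℝ} (hg : g ∈ specialOrthogonalGroup (Fin 3) ℝ)
    (v w : Config N) : dist (act g v) (act g w) = dist v w := by
  have h : ∀ i, dist (act g v i) (act g w i) = dist (v i) (w i) := fun i => by
    rw [act_apply, act_apply, dist_eq_norm, ← map_sub, norm_op hg, dist_eq_norm]
  simp only [dist_pi_def, nndist_dist, h]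

/-- Rotated values of `y` at vectors of length `|ω|` approach the orbit of `a`. -/
lemma tendsto_nhdsSet_orbit {y : E3 → Config N} (hy : Tendsto y (𝓝 0) (𝓝 a)) {ω₀ : ℝ}
    (hω₀ : 0 < ω₀) {b : ℝ → Config N}
    (hb : ∀ ω, |ω| < ω₀ → ∃ n : E3, ‖n‖ = 1 ∧ ∃ g ∈ specialOrthogonalGroup (Fin 3) ℝ,
      b ω = act g (y (ω • n))) :
    Tendsto b (𝓝 0) (𝓝ˢ (orbitSO3 a)) := by
  rw [(hasBasis_nhdsSet _).tendsto_right_iff]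
  rintro U ⟨hU, haU⟩
  obtain ⟨ε, hε, hεU⟩ := (isCompact_orbitSO3 a).exists_thickening_subset_open hU haU
  obtain ⟨δ, hδ, hball⟩ :=
    Metric.eventually_nhds_iff.mp (hy.eventually (Metric.ball_mem_nhds a hε))
  refine Metric.eventually_nhds_iff.mpr ⟨min δ ω₀, lt_min hδ hω₀, fun ω hω => ?_⟩
  rw [Real.dist_eq, sub_zero] at hω
  obtain ⟨n, hn, g, hg, hbω⟩ := hb ω (hω.trans_le (min_le_right _ _))
  refine hεU (Metric.mem_thickening_iff.mpr ⟨act g a, ⟨g, hg, rfl⟩, ?_⟩)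
  rw [hbω, dist_act hg]
  refine hball ?_
  rw [dist_zero_right, norm_smul, hn, mul_one]
  exact hω.trans_le (min_le_left _ _)

end

end

end SphereVortex

theorem mainTheorem4 (N : ℕ) (hN : 3 ≤ N) (Γ : Fin N → ℝ) (hΓ : ∀ i, Γ i ≠ 0)
    (a₀ : SphereVortex.Config N) (ha₀ : SphereVortex.IsEquilibrium Γ a₀)
    (hnd : SphereVortex.IsNondegenerateCriticalManifold
      (SphereVortex.hamiltonian Γ) (SphereVortex.orbitSO3 a₀)) :
    ∃ ω₀ : ℝ, 0 < ω₀ ∧ ∃ a₁ a₂ : ℝ → SphereVortex.Config N,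
      (∀ ω : ℝ, |ω| < ω₀ →
        SphereVortex.IsRelativeEquilibrium Γ (a₁ ω) ω ∧
        SphereVortex.IsRelativeEquilibrium Γ (a₂ ω) ω ∧
        SphereVortex.orbitSO2 (a₁ ω) ≠ SphereVortex.orbitSO2 (a₂ ω)) ∧
      Filter.Tendsto a₁ (nhds 0) (nhdsSet (SphereVortex.orbitSO3 a₀)) ∧
      Filter.Tendsto a₂ (nhds 0) (nhdsSet (SphereVortex.orbitSO3 a₀)) := by
  have ha : a₀ ∈ SphereVortex.phaseSpace N := (ha₀ 0).1
  have hmem : a₀ ∈ SphereVortex.orbitSO3 a₀ := ⟨1, one_mem _, (SphereVortex.act_one a₀).symm⟩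
  obtain ⟨hcrit, hker⟩ := hnd.2.2 a₀ hmem
  obtain ⟨y, hy, ω₀, hω₀, H⟩ :=
    SphereVortex.exists_relativeEquilibria hN hΓ ha hcrit.2 hker
  choose! n₁ n₂ g₁ hg₁ g₂ hg₂ hn₁ hn₂ h₁ h₂ hne using H
  refine ⟨ω₀, hω₀, fun ω => SphereVortex.act (g₁ ω) (y (ω • n₁ ω)),
    fun ω => SphereVortex.act (g₂ ω) (y (ω • n₂ ω)),
    fun ω hω => ⟨h₁ ω hω, h₂ ω hω, hne ω hω⟩, ?_, ?_⟩
  · exact SphereVortex.tendsto_nhdsSet_orbit hy hω₀ fun ω hω =>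
      ⟨n₁ ω, hn₁ ω hω, g₁ ω, hg₁ ω hω, rfl⟩
  · exact SphereVortex.tendsto_nhdsSet_orbit hy hω₀ fun ω hω =>
      ⟨n₂ ω, hn₂ ω hω, g₂ ω, hg₂ ω hω, rfl⟩
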